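/- Let $\mathcal H$ be a complex Hilbert space, $n\ge 1$, and let $A_1,\dots,A_n$ be (possibly unbounded) selfadjoint operators in $\mathcal H$ such that $\mathcal D:=\mathcal D(A_1)\cap\dots\cap\mathcal D(A_n)$ is dense. Let $\mathcal C\subset\mathbb C$ be open and dense, let $f^{(1)},\dots,f^{(n)},g:\mathcal C\to\mathbb C$, and assume that for every $\omega\in\mathcal C$ the operator $\widehat T(\omega)=g(\omega)+\sum_{j=1}^n f^{(j)}(\omega)A_j$ with domain $\mathcal D$ is closable; let $T(\omega)$ be its closure. For $\alpha\in\mathbb R^n$ put $t_\alpha(\omega)=g(\omega)+\sum_{j=1}^n\alpha_jf^{(j)}(\omega)$, and for $X\subset\mathbb R^n$ and $\epsilon>0$ put $$W_X(T)=\{\omega\in\mathcal C:\exists\,\alpha\in X,\ t_\alpha(\omega)=0\},\qquad W_X^\epsilon(T)=\{\omega\in\mathcal C:\exists\,\alpha\in X,\ |t_\alpha(\omega)|<\epsilon\}.$$ Let $W(A_j)=\{\langle A_ju,u\rangle:u\in\mathcal D(A_j),\|u\|=1\}$, let $W(A_1,\dots,A_n)=\{(\langle A_1u,u\rangle,\dots,\langle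 A_nu,u\rangle):u\in\mathcal D,\|u\|=1\}$, and let $\Omega\subset\mathbb R^n$ be a closed set with $W(A_1,\dots,A_n)\subset\Omega\subset\overline{W(A_1)}\times\dots\times\overline{W(A_n)}$. For a closed set $\Omega\subset\mathbb R^n$ let $J_\Omega$ be the set of those $j$ for which $\alpha_j$ is unbounded both from below and from above on $\Omega$. The $m$-skeleton $\Omega_m$ is defined as follows. For $m<0$, $\Omega_m:=\Omega$. For $m\ge 0$ and $J_\Omega\ne\emptyset$, iteratively, $\Omega_m:=(\Omega^+)_m\cup(\Omega^-)_m$ with $\Omega^\pm:=\{\alpha\in\Omega:\pm\alpha_{\min J_\Omega}\ge 0\}$. For $J_\Omega=\emptyset$, $\Omega_0:=\partial\Omega$, and for $m>0$, $\Omega_m$ is the set of $\alpha\in\Omega$ for which there is an $m$-dimensional affine subspace $P$ with $\Omega\cap P=\{\alpha\}$. Let $\mathcal C^i$ be the set of $\omega\in\mathcal C$ at which the real $2\times n$ matrix with columns $(\operatorname{Re}f^{(j)}(\omega),\operatorname{Im}f^{(j)}(\omega))^{T}$ has rank less than $2$. Let $C$ be the set of points of $\mathcal C$ at which $f^{(1)},\dots,f^{(n)},g$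 are continuous. Fix $\epsilon>0$ and let $H$ be the set of points $\omega\in\mathcal C$ such that $f^{(1)},\dots,f^{(n)},g$ are holomorphic in a neighborhood of $\omega$ and linearly independent over $\mathbb R$ in every neighborhood of $\omega$, and such that for no $\alpha\in\Omega$ the function $|t_\alpha|$ is identically equal to $\epsilon$ in a neighborhood of $\omega$. If $n=2$ or $\Omega$ is convex or $\Omega$ is bounded, let $m:=n-2$; otherwise let $m:=n-3$. Then: (i) $W^\epsilon_{\Omega_m}(T)\setminus W_\Omega(T)=W^\epsilon_{\Omega}(T)\setminus W_\Omega(T)$; (ii) $\bigl(W^\epsilon_{\Omega_{n-2}}(T)\cap\mathcal C^i\bigr)\setminus W_\Omega(T)=\bigl(W^\epsilon_{\Omega}(T)\cap\mathcal C^i\bigr)\setminus W_\Omega(T)$; (iii) $\{\omega\in\partial W^\epsilon_\Omega(T)\cap C:\ \omega\notin\partial W^{\epsilon'}_\Omega(T)\text{ for all }\epsilon'>\epsilon\}\subset\{\omega\in C:\inf_{\alpha\in\Omega}|t_\alpha(\omega)|=\epsilon\}$; (iv) $\{\omega\in\partial W^\epsilon_\Omega(T)\cap H:\ \omega\notin\partial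 W^{\epsilon'}_\Omega(T)\text{ for all }\epsilon'>\epsilon\}=\{\omega\in H:\inf_{\alpha\in\Omega}|t_\alpha(\omega)|=\epsilon\}$. -/

import Mathlib

open Filter Topology

/-! ## Numerical ranges of (unbounded) selfadjoint operators -/

/-- The numerical range `W(A) = {⟨A u, u⟩ : u ∈ D(A), ‖u‖ = 1}` of an operator whose quadratic
form is real (such as a selfadjoint operator), as a subset of `ℝ`. -/
def numRange {E : Type*} [NormedAddCommGroup E] [InnerProductSpace ℂ E]
    (A : E →ₗ.[ℂ] E) : Set ℝ :=
  {x | ∃ u : A.domain, ‖(u : E)‖ = 1 ∧ (x : ℂ) = inner ℂ (u : E) (A u)}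

/-- `D(A₁) ∩ ⋯ ∩ D(Aₙ)`. -/
def commonDomain {E : Type*} [NormedAddCommGroup E] [InnerProductSpace ℂ E] {n : ℕ}
    (A : Fin n → E →ₗ.[ℂ] E) : Submodule ℂ E :=
  ⨅ j, (A j).domain

/-- The inclusion of the common domain into `D(Aⱼ)`. -/
def commonDomainIncl {E : Type*} [NormedAddCommGroup E] [InnerProductSpace ℂ E] {n : ℕ}
    (A : Fin n → E →ₗ.[ℂ] E) (j : Fin n) : commonDomain A →ₗ[ℂ] (A j).domain :=
  Submodule.inclusion (iInf_le (fun j => (A j).domain) j)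

/-- The joint numerical range
`W(A₁,…,Aₙ) = {(⟨A₁ u, u⟩, …, ⟨Aₙ u, u⟩) : u ∈ D(A₁) ∩ ⋯ ∩ D(Aₙ), ‖u‖ = 1} ⊆ ℝⁿ`. -/
def jointNumRange {E : Type*} [NormedAddCommGroup E] [InnerProductSpace ℂ E] {n : ℕ}
    (A : Fin n → E →ₗ.[ℂ] E) : Set (Fin n → ℝ) :=
  {α | ∃ u : commonDomain A, ‖(u : E)‖ = 1 ∧
    ∀ j, (α j : ℂ) = inner ℂ (u : E) (A j (commonDomainIncl A j u))}

/-- The operator `g(ω) + ∑ⱼ f⁽ʲ⁾(ω) Aⱼ` with domain `D(A₁) ∩ ⋯ ∩ D(Aₙ)`. -/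
noncomputable def preOperator {E : Type*} [NormedAddCommGroup E] [InnerProductSpace ℂ E] {n : ℕ}
    (A : Fin n → E →ₗ.[ℂ] E) (f : Fin n → ℂ → ℂ) (g : ℂ → ℂ) (ω : ℂ) : E →ₗ.[ℂ] E where
  domain := commonDomain A
  toFun := g ω • (commonDomain A).subtype +
    ∑ j, f j ω • ((A j).toFun ∘ₗ commonDomainIncl A j)

/-! ## The scalar functions and the enclosures -/

/-- `t_α(ω) = g(ω) + ∑ⱼ αⱼ f⁽ʲ⁾(ω)`. -/
noncomputable def tFun {n : ℕ} (f : Fin n → ℂ → ℂ) (g : ℂ → ℂ) (α : Fin n → ℝ) (ω : ℂ) : ℂ :=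
  g ω + ∑ j, (α j : ℂ) * f j ω

/-- `W_X(T) = {ω ∈ 𝒞 : ∃ α ∈ X, t_α(ω) = 0}`. -/
def enclosure {n : ℕ} (𝒞 : Set ℂ) (f : Fin n → ℂ → ℂ) (g : ℂ → ℂ)
    (X : Set (Fin n → ℝ)) : Set ℂ :=
  {ω | ω ∈ 𝒞 ∧ ∃ α ∈ X, tFun f g α ω = 0}

/-- `W_X^ε(T) = {ω ∈ 𝒞 : ∃ α ∈ X, |t_α(ω)| < ε}`. -/
def pseudoEnclosure {n : ℕ} (𝒞 : Set ℂ) (f : Fin n → ℂ → ℂ) (g : ℂ → ℂ)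
    (X : Set (Fin n → ℝ)) (ε : ℝ) : Set ℂ :=
  {ω | ω ∈ 𝒞 ∧ ∃ α ∈ X, ‖tFun f g α ω‖ < ε}

/-- `inf_{α ∈ X} |t_α(ω)|` (for nonempty `X`; the value at `X = ∅` is `0`). -/
noncomputable def infModulus {n : ℕ} (f : Fin n → ℂ → ℂ) (g : ℂ → ℂ)
    (X : Set (Fin n → ℝ)) (ω : ℂ) : ℝ :=
  sInf ((fun α => ‖tFun f g α ω‖) '' X)

/-- The real `2 × n` matrix `F(ω)` with rows `Re f⁽ʲ⁾(ω)` and `Im f⁽ʲ⁾(ω)`. -/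
noncomputable def coeffMatrix {n : ℕ} (f : Fin n → ℂ → ℂ) (ω : ℂ) : Matrix (Fin 2) (Fin n) ℝ :=
  Matrix.of ![fun j => (f j ω).re, fun j => (f j ω).im]

/-- `𝒞ⁱ = {ω ∈ 𝒞 : rank F(ω) < 2}`. -/
def degenerateSet {n : ℕ} (𝒞 : Set ℂ) (f : Fin n → ℂ → ℂ) : Set ℂ :=
  {ω | ω ∈ 𝒞 ∧ (coeffMatrix f ω).rank < 2}

/-- The set `C` of points of `𝒞` at which `f⁽¹⁾, …, f⁽ⁿ⁾, g` are continuous. -/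
def contSet {n : ℕ} (𝒞 : Set ℂ) (f : Fin n → ℂ → ℂ) (g : ℂ → ℂ) : Set ℂ :=
  {ω | ω ∈ 𝒞 ∧ ContinuousAt g ω ∧ ∀ j, ContinuousAt (f j) ω}

/-- The set `H` of points of `𝒞` at which `g, f⁽¹⁾, …, f⁽ⁿ⁾` are holomorphic and linearly
independent (over `ℝ`, as germs), and near which none of the functions `|t_α|`, `α ∈ Ω`,
is identically equal to `ε`. -/
def holoSet {n : ℕ} (𝒞 : Set ℂ) (f : Fin n → ℂ → ℂ) (g : ℂ → ℂ)
    (Ω : Set (Fin n → ℝ)) (ε : ℝ) : Set ℂ :=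
  {ω | ω ∈ 𝒞 ∧ AnalyticAt ℂ g ω ∧ (∀ j, AnalyticAt ℂ (f j) ω) ∧
    LinearIndependent ℝ (fun i : Fin (n + 1) =>
      (((Fin.cons g f : Fin (n + 1) → ℂ → ℂ) i : ℂ → ℂ) : Germ (𝓝 ω) ℂ)) ∧
    ∀ α ∈ Ω, ¬ ∀ᶠ z in 𝓝 ω, ‖tFun f g α z‖ = ε}

/-! ## Skeletons -/

/-- `J_Ω`: the coordinates that are unbounded on `Ω` both from below and from above. -/
noncomputable def unbddCoords {n : ℕ} (Ω : Set (Fin n → ℝ)) : Finset (Fin n) := by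
  classical
  exact Finset.univ.filter fun j =>
    ¬ BddBelow ((fun α => α j) '' Ω) ∧ ¬ BddAbove ((fun α => α j) '' Ω)

theorem mem_unbddCoords {n : ℕ} {Ω : Set (Fin n → ℝ)} {j : Fin n} :
    j ∈ unbddCoords Ω ↔
      ¬ BddBelow ((fun α => α j) '' Ω) ∧ ¬ BddAbove ((fun α => α j) '' Ω) := by
  classical
  simp [unbddCoords]

theorem unbddCoords_mono {n : ℕ} {Ω Ω' : Set (Fin n → ℝ)} (h : Ω' ⊆ Ω) :
    unbddCoords Ω' ⊆ unbddCoords Ω := by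
  intro j hj
  rw [mem_unbddCoords] at hj ⊢
  exact ⟨fun hb => hj.1 (hb.mono (Set.image_mono h)),
    fun hb => hj.2 (hb.mono (Set.image_mono h))⟩

theorem card_unbddCoords_nonneg_lt {n : ℕ} {Ω : Set (Fin n → ℝ)} {j : Fin n}
    (hj : j ∈ unbddCoords Ω) :
    (unbddCoords {α ∈ Ω | 0 ≤ α j}).card < (unbddCoords Ω).card := by
  refine Finset.card_lt_card ⟨unbddCoords_mono (Set.sep_subset _ _), fun h => ?_⟩
  refine (mem_unbddCoords.1 (h hj)).1 ⟨0, ?_⟩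
  rintro _ ⟨α, hα, rfl⟩
  exact hα.2

theorem card_unbddCoords_nonpos_lt {n : ℕ} {Ω : Set (Fin n → ℝ)} {j : Fin n}
    (hj : j ∈ unbddCoords Ω) :
    (unbddCoords {α ∈ Ω | α j ≤ 0}).card < (unbddCoords Ω).card := by
  refine Finset.card_lt_card ⟨unbddCoords_mono (Set.sep_subset _ _), fun h => ?_⟩
  refine (mem_unbddCoords.1 (h hj)).2 ⟨0, ?_⟩
  rintro _ ⟨α, hα, rfl⟩
  exact hα.2

/-- The `m`-skeleton of a set with `J_Ω = ∅`: the boundary if `m = 0`, and for `m > 0` the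
points `α ∈ Ω` such that some `m`-dimensional affine subspace meets `Ω` exactly in `α`. -/
def baseSkeleton {n : ℕ} (m : ℕ) (Ω : Set (Fin n → ℝ)) : Set (Fin n → ℝ) :=
  if m = 0 then frontier Ω
  else {α | α ∈ Ω ∧ ∃ P : AffineSubspace ℝ (Fin n → ℝ),
    Module.finrank ℝ P.direction = m ∧ Ω ∩ (P : Set (Fin n → ℝ)) = {α}}

/-- The `m`-skeleton `Ω_m` for `m ≥ 0`: if `J_Ω ≠ ∅` it is `Ω⁺_m ∪ Ω⁻_m`, where
`Ω^± = {α ∈ Ω : ± α_{min J_Ω} ≥ 0}`. -/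
noncomputable def natSkeleton {n : ℕ} (m : ℕ) (Ω : Set (Fin n → ℝ)) : Set (Fin n → ℝ) :=
  if h : (unbddCoords Ω).Nonempty then
    natSkeleton m {α ∈ Ω | 0 ≤ α ((unbddCoords Ω).min' h)} ∪
      natSkeleton m {α ∈ Ω | α ((unbddCoords Ω).min' h) ≤ 0}
  else baseSkeleton m Ω
termination_by (unbddCoords Ω).card
decreasing_by
  · exact card_unbddCoords_nonneg_lt (Finset.min'_mem _ h)
  · exact card_unbddCoords_nonpos_lt (Finset.min'_mem _ h)

/-- The `m`-skeleton `Ω_m`, with the convention `Ω_m = Ω` for `m < 0`. -/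
noncomputable def skeleton {n : ℕ} (m : ℤ) (Ω : Set (Fin n → ℝ)) : Set (Fin n → ℝ) :=
  if m < 0 then Ω else natSkeleton m.toNat Ω

open Classical in
/-- `n - 2` if `n = 2` or `Ω ⊆ ℝⁿ` is convex or bounded, and `n - 3` otherwise. -/
noncomputable def skeletonIndex {n : ℕ} (Ω : Set (Fin n → ℝ)) : ℤ :=
  if n = 2 ∨ Convex ℝ Ω ∨ Bornology.IsBounded Ω then (n : ℤ) - 2 else (n : ℤ) - 3

/-! As a function of `α`, `t_α(ω)` is an affine map `ℝⁿ → ℂ`.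

For the skeletons, split `Ω` until `J_Ω = ∅`, so that every coordinate is bounded on one side. Then
a small multiple of a sum of square roots of the shifted coordinates can be added to a linear
functional bounded below on `Ω`: the sum has a minimizer, and strict concavity of the root makes a
supporting hyperplane meet `Ω` in that single point. Applied on a fibre of `α ↦ t_α(ω)`, this
gives a point of the skeleton with the same value of `t_α(ω)`; that fibre has dimension at least
`n - 2`, and at least `n - 1` when `F(ω)` has rank less than `2`. If `t_α(ω)` has no zero on `Ω`,
one dimension is gained by fixing only the direction of `t_α(ω)`: on the resulting slice `t_α(ω)` is
a fixed unit times a real affine function, which keeps one sign if `Ω` is convex and stays away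
from `0` if `Ω` is bounded, so it can be minimized approximately at an exposed point of its positive
part. The `0`-skeleton only needs connectedness: a line in the fibre, or for `n = 2` the convex set
where `|t_α(ω)| < ε`, meets `Ω` without being contained in it, hence meets `∂Ω`.

For the boundaries, the point is that `inf_α |t_α(ω)| = ε` places `ω` in the closure of
`W_Ω^ε(T)`. Otherwise no `t_α`, `α ∈ Ω`, vanishes near `ω`. A Hurwitz argument, applied to
the limits of the normalized combinations of the linearly independent germs `g, f⁽¹⁾, …, f⁽ⁿ⁾`,
shows that `α ↦ |t_α(ω)|` is coercive on `Ω`, so the infimum is attained at some `α`. Then `|t_α|`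
has a local minimum `ε > 0` at `ω`, hence is constant near `ω`, contradicting `ω ∈ H`.
-/

section StrictConcaveGauge

/-- A nonnegative function `Φ` that is proper on `S` and has, at each point of `S`, a supergradient
that is strict on `S`; `C` bounds the norms of these supergradients. Adding a small multiple of `Φ`
to a linear functional bounded below on `S` produces minimizers that are exposed points of `S`. -/
structure IsStrictConcaveGauge {E : Type*} [NormedAddCommGroup E] [NormedSpace ℝ E]
    (Φ : E → ℝ) (S : Set E) (C : ℝ) : Prop where
  continuous : Continuous Φ
  nonneg : ∀ x, 0 ≤ Φ x
  isBounded_sublevel : ∀ R, Bornology.IsBounded {x ∈ S | Φ x ≤ R}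
  exists_supergradient : ∀ x ∈ S, ∃ d : StrongDual ℝ E, ‖d‖ ≤ C ∧
    ∀ y ∈ S, y ≠ x → Φ y < Φ x + d (y - x)

theorem sqrt_lt_sqrt_add_div {a b : ℝ} (ha : 0 < a) (hb : 0 ≤ b) (hab : b ≠ a) :
    √b < √a + (b - a) / (2 * √a) := by
  have hne : √b - √a ≠ 0 := sub_ne_zero.2 fun h => hab ((Real.sqrt_inj hb ha.le).1 h)
  have hpos : 0 < √a := Real.sqrt_pos.2 ha
  have hsq : 0 < (√b - √a) ^ 2 := by positivity
  rw [← sub_lt_iff_lt_add', lt_div_iff₀ (mul_pos two_pos hpos)]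
  nlinarith [Real.sq_sqrt ha.le, Real.sq_sqrt hb]

theorem isStrictConcaveGauge_sqrt {σ : ℝ} (hσ : |σ| = 1) (b : ℝ) :
    IsStrictConcaveGauge (fun x : ℝ => √(σ * x - b + 1)) {x | b ≤ σ * x} 1 where
  continuous := by fun_prop
  nonneg _ := Real.sqrt_nonneg _
  isBounded_sublevel R := by
    refine isBounded_iff_forall_norm_le.2 ⟨|b| + R ^ 2, fun x ⟨hbx, hxR⟩ => ?_⟩
    have hle : σ * x - b + 1 ≤ R ^ 2 := (Real.sqrt_le_left ((Real.sqrt_nonneg _).trans hxR)).1 hxR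
    have hnorm : ‖x‖ = |σ * x| := by rw [abs_mul, hσ, one_mul, Real.norm_eq_abs]
    rw [hnorm, abs_le]
    have hbx : b ≤ σ * x := hbx
    constructor <;> linarith [neg_abs_le b, le_abs_self b, sq_nonneg R]
  exists_supergradient x hx := by
    have hx : b ≤ σ * x := hx
    have hone : 1 ≤ √(σ * x - b + 1) := Real.one_le_sqrt.2 (by linarith)
    refine ⟨(σ / (2 * √(σ * x - b + 1))) • .id ℝ ℝ, ?_, fun y hy hyx => ?_⟩
    · rw [norm_smul, ContinuousLinearMap.norm_id, mul_one, Real.norm_eq_abs, abs_div, hσ,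
        abs_of_pos (by linarith), div_le_one (by linarith)]
      linarith
    · have hy : b ≤ σ * y := hy
      have hσ0 : σ ≠ 0 := fun h => by simp [h] at hσ
      have hne : σ * y - b + 1 ≠ σ * x - b + 1 := fun h =>
        hyx (mul_left_cancel₀ hσ0 (by linarith))
      convert sqrt_lt_sqrt_add_div (by linarith) (by linarith) hne using 2
      simp only [smul_apply, ContinuousLinearMap.id_apply, smul_eq_mul]
      ring

namespace IsStrictConcaveGauge

variable {E : Type*} [NormedAddCommGroup E] [NormedSpace ℝ E] {Φ : E → ℝ} {S T : Set E} {C : ℝ}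

theorem mono (hΦ : IsStrictConcaveGauge Φ S C) (hTS : T ⊆ S) : IsStrictConcaveGauge Φ T C where
  continuous := hΦ.continuous
  nonneg := hΦ.nonneg
  isBounded_sublevel R := (hΦ.isBounded_sublevel R).subset fun _ hx => ⟨hTS hx.1, hx.2⟩
  exists_supergradient x hx :=
    (hΦ.exists_supergradient x (hTS hx)).imp fun _ hd => ⟨hd.1, fun y hy => hd.2 y (hTS hy)⟩

theorem pi {ι : Type*} [Fintype ι] {X : ι → Type*} [∀ i, NormedAddCommGroup (X i)]
    [∀ i, NormedSpace ℝ (X i)] {φ : ∀ i, X i → ℝ} {s : ∀ i, Set (X i)} {c : ι → ℝ}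
    (hφ : ∀ i, IsStrictConcaveGauge (φ i) (s i) (c i)) :
    IsStrictConcaveGauge (fun x => ∑ i, φ i (x i)) (Set.univ.pi s) (∑ i, c i) where
  continuous := continuous_finsetSum _ fun i _ => (hφ i).continuous.comp (continuous_apply i)
  nonneg x := Finset.sum_nonneg fun i _ => (hφ i).nonneg (x i)
  isBounded_sublevel R := by
    refine (Bornology.IsBounded.pi fun i => (hφ i).isBounded_sublevel R).subset ?_
    intro x ⟨hx, hxR⟩ i _
    exact ⟨hx i trivial, (Finset.single_le_sum (f := fun i => φ i (x i))
      (fun j _ => (hφ j).nonneg (x j)) (Finset.mem_univ i)).trans hxR⟩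
  exists_supergradient x hx := by
    choose d hdc hd using fun i => (hφ i).exists_supergradient (x i) (hx i trivial)
    refine ⟨∑ i, (d i).comp (.proj i), norm_sum_le_of_le _ fun i _ => ?_, fun y hy hyx => ?_⟩
    · have hc : 0 ≤ c i := (norm_nonneg _).trans (hdc i)
      refine ContinuousLinearMap.opNorm_le_bound _ hc fun v => ?_
      exact (d i).le_of_opNorm_le_of_le (hdc i) (norm_le_pi_norm v i)
    · obtain ⟨j, hj⟩ := Function.ne_iff.1 hyx
      simp only [sum_apply, ContinuousLinearMap.comp_apply,
        ContinuousLinearMap.proj_apply, Pi.sub_apply, ← Finset.sum_add_distrib]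
      refine Finset.sum_lt_sum (fun i _ => ?_) ⟨j, Finset.mem_univ j, hd j _ (hy j trivial) hj⟩
      rcases eq_or_ne (y i) (x i) with heq | hne
      · simp [heq]
      · exact (hd i _ (hy i trivial) hne).le

theorem exists_isMinOn_add_smul [ProperSpace E] (hΦ : IsStrictConcaveGauge Φ S C)
    (hS : IsClosed S) {l : StrongDual ℝ E} (hl : BddBelow (l '' S)) (hne : S.Nonempty)
    {δ : ℝ} (hδ : 0 < δ) : ∃ x ∈ S, IsMinOn (fun y => l y + δ * Φ y) S x := by
  obtain ⟨a, ha⟩ := hne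
  obtain ⟨b, hb⟩ := hl
  have hcont : Continuous fun y => l y + δ * Φ y := by
    have := hΦ.continuous
    fun_prop
  refine hcont.continuousOn.exists_isMinOn' hS ha ?_
  have hbdd := hΦ.isBounded_sublevel ((l a + δ * Φ a - b) / δ)
  rw [eventually_inf_principal, ← Metric.cobounded_eq_cocompact]
  filter_upwards [Bornology.isBounded_def.1 hbdd] with y hy hyS
  have hlarge : (l a + δ * Φ a - b) / δ < Φ y := not_le.1 fun h => hy ⟨hyS, h⟩
  rw [div_lt_iff₀' hδ] at hlarge
  linarith [hb ⟨y, hyS, rfl⟩]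

theorem exists_exposed_near [ProperSpace E] (hΦ : IsStrictConcaveGauge Φ S C) (hS : IsClosed S)
    {l : StrongDual ℝ E} (hl : BddBelow (l '' S)) {a : E} (ha : a ∈ S) {η ρ : ℝ} (hη : 0 < η)
    (hρ : 0 < ρ) :
    ∃ x ∈ S, l x < l a + η ∧ ∃ p : StrongDual ℝ E, ‖p - l‖ ≤ ρ ∧ ∀ y ∈ S, y ≠ x → p x < p y := by
  have hΦa := hΦ.nonneg a
  set δ := min (η / (Φ a + 1)) (ρ / (|C| + 1))
  have hδ : 0 < δ := by positivity
  have hδη : δ * (Φ a + 1) ≤ η := (le_div_iff₀ (by positivity)).1 (min_le_left _ _)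
  have hδρ : δ * (|C| + 1) ≤ ρ := (le_div_iff₀ (by positivity)).1 (min_le_right _ _)
  obtain ⟨x, hx, hmin⟩ := hΦ.exists_isMinOn_add_smul hS hl ⟨a, ha⟩ hδ
  obtain ⟨d, hdC, hd⟩ := hΦ.exists_supergradient x hx
  refine ⟨x, hx, ?_, l + δ • d, ?_, fun y hy hyx => ?_⟩
  · have hxa : l x + δ * Φ x ≤ l a + δ * Φ a := hmin ha
    nlinarith [hΦ.nonneg x]
  · rw [add_sub_cancel_left, norm_smul, Real.norm_of_nonneg hδ.le]
    nlinarith [le_abs_self C]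
  · have hxy : l x + δ * Φ x ≤ l y + δ * Φ y := hmin hy
    have hlt := mul_lt_mul_of_pos_left (hd y hy hyx) hδ
    rw [map_sub] at hlt
    simp only [add_apply, smul_apply, smul_eq_mul]
    linarith

end IsStrictConcaveGauge

end StrictConcaveGauge

section OneSidedBounds

variable {n : ℕ} {Ω : Set (Fin n → ℝ)}

theorem exists_isStrictConcaveGauge (hJ : unbddCoords Ω = ∅) :
    ∃ Φ C, IsStrictConcaveGauge Φ Ω C := by
  have hbdd : ∀ j, ∃ σ b : ℝ, |σ| = 1 ∧ ∀ α ∈ Ω, b ≤ σ * α j := by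
    intro j
    have hj : j ∉ unbddCoords Ω := by simp [hJ]
    rw [mem_unbddCoords, not_and_or, not_not, not_not] at hj
    rcases hj with ⟨b, hb⟩ | ⟨b, hb⟩
    · exact ⟨1, b, abs_one, fun α hα => by simpa using hb ⟨α, hα, rfl⟩⟩
    · exact ⟨-1, -b, by simp, fun α hα => by simpa using hb ⟨α, hα, rfl⟩⟩
  choose σ b hσ hb using hbdd
  exact ⟨_, _, (IsStrictConcaveGauge.pi fun j => isStrictConcaveGauge_sqrt (hσ j) (b j)).mono
    fun α hα j _ => hb j α hα⟩

theorem exists_add_smul_notMem (hJ : unbddCoords Ω = ∅) (α : Fin n → ℝ) {v : Fin n → ℝ}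
    (hv : v ≠ 0) : ∃ t : ℝ, α + t • v ∉ Ω := by
  by_contra! hline
  obtain ⟨j, hj⟩ : ∃ j, v j ≠ 0 := Function.ne_iff.1 hv
  have hsurj : (fun β : Fin n → ℝ => β j) '' Ω = Set.univ :=
    Set.eq_univ_of_forall fun s => ⟨_, hline ((s - α j) / v j), by simp [hj]⟩
  have hmem : j ∈ unbddCoords Ω := by
    rw [mem_unbddCoords, hsurj]
    exact ⟨not_bddBelow_univ, not_bddAbove_univ⟩
  simp [hJ] at hmem

end OneSidedBounds

section Skeletons

theorem inter_frontier_nonempty_of_isPreconnected {X : Type*} [TopologicalSpace X] {s t : Set X}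
    (ht : IsPreconnected t) (hs : (t ∩ s).Nonempty) (hsc : (t ∩ sᶜ).Nonempty) :
    (t ∩ frontier s).Nonempty := by
  by_contra! hempty
  have hint : ∀ x ∈ t, x ∈ closure s → x ∈ interior s := fun x hxt hxs => by
    by_contra hxi
    exact (Set.eq_empty_iff_forall_notMem.1 hempty) x ⟨hxt, hxs, hxi⟩
  have hsub : t ⊆ interior s :=
    ht.subset_of_closure_inter_subset isOpen_interior
      (hs.mono fun x hx => ⟨hx.1, hint x hx.1 (subset_closure hx.2)⟩)
      fun x hx => hint x hx.2 (closure_mono interior_subset hx.1)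
  obtain ⟨y, hyt, hys⟩ := hsc
  exact hys (interior_subset (hsub hyt))

theorem finrank_le_finrank_ker_add_finrank {K V W : Type*} [DivisionRing K] [AddCommGroup V]
    [Module K V] [FiniteDimensional K V] [AddCommGroup W] [Module K W] [FiniteDimensional K W]
    (f : V →ₗ[K] W) :
    Module.finrank K V ≤ Module.finrank K (LinearMap.ker f) + Module.finrank K W := by
  have hrange := Submodule.finrank_le (LinearMap.range f)
  have hrank := LinearMap.finrank_range_add_finrank_ker f
  omega

theorem exists_submodule_le_finrank_eq {K V : Type*} [DivisionRing K] [AddCommGroup V]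
    [Module K V] {W : Submodule K V} {m : ℕ} (hm : m ≤ Module.finrank K W) :
    ∃ U ≤ W, Module.finrank K U = m := by
  obtain ⟨b, hb⟩ := exists_linearIndependent_of_le_finrank hm
  refine ⟨(Submodule.span K (Set.range b)).map W.subtype, Submodule.map_subtype_le _ _, ?_⟩
  rw [Submodule.finrank_map_subtype_eq, finrank_span_eq_card hb, Fintype.card_fin]

theorem finrank_le_finrank_inf_ker_add_one {K V : Type*} [DivisionRing K] [AddCommGroup V]
    [Module K V] [FiniteDimensional K V] (W : Submodule K V) (p : V →ₗ[K] K) :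
    Module.finrank K W ≤ Module.finrank K ↥(W ⊓ LinearMap.ker p) + 1 := by
  have hker := finrank_le_finrank_ker_add_finrank p
  have hsup := Submodule.finrank_le (W ⊔ LinearMap.ker p)
  have hdim := Submodule.finrank_sup_add_finrank_inf_eq W (LinearMap.ker p)
  rw [Module.finrank_self] at hker
  omega

variable {n m : ℕ} {Ω : Set (Fin n → ℝ)}

theorem mem_baseSkeleton_of_forall_eq (hm : m ≠ 0) {x : Fin n → ℝ} (hx : x ∈ Ω)
    {V : Submodule ℝ (Fin n → ℝ)} (hV : m + 1 ≤ Module.finrank ℝ V)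
    (p : (Fin n → ℝ) →ₗ[ℝ] ℝ) (h : ∀ y ∈ Ω, y - x ∈ V → p y = p x → y = x) :
    x ∈ baseSkeleton m Ω := by
  obtain ⟨U, hU, hUm⟩ := exists_submodule_le_finrank_eq (m := m) (W := V ⊓ LinearMap.ker p)
    (by have := finrank_le_finrank_inf_ker_add_one V p; omega)
  rw [baseSkeleton, if_neg hm]
  refine ⟨hx, AffineSubspace.mk' x U, by rw [AffineSubspace.direction_mk', hUm], ?_⟩
  refine Set.Subset.antisymm (fun y ⟨hy, hyU⟩ => ?_) ?_
  · obtain ⟨hyV, hyp⟩ := hU (AffineSubspace.mem_mk'.1 hyU)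
    refine h y hy hyV ?_
    rwa [SetLike.mem_coe, LinearMap.mem_ker, vsub_eq_sub, map_sub, sub_eq_zero] at hyp
  · rintro _ rfl
    exact ⟨hx, AffineSubspace.self_mem_mk' _ _⟩

theorem exists_mem_baseSkeleton_sub_mem (hΩ : IsClosed Ω) (hJ : unbddCoords Ω = ∅)
    {V : Submodule ℝ (Fin n → ℝ)} (hV : m + 1 ≤ Module.finrank ℝ V) {α : Fin n → ℝ}
    (hα : α ∈ Ω) : ∃ x ∈ baseSkeleton m Ω, x - α ∈ V := by
  rcases eq_or_ne m 0 with rfl | hm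
  · obtain ⟨v, hvV, hv⟩ := V.exists_mem_ne_zero_of_ne_bot fun h => by simp [h] at hV
    obtain ⟨t, ht⟩ := exists_add_smul_notMem hJ α hv
    have hline : IsPreconnected (Set.range fun s : ℝ => α + s • v) :=
      isPreconnected_range (by fun_prop)
    obtain ⟨_, ⟨s, rfl⟩, hs⟩ := inter_frontier_nonempty_of_isPreconnected hline
      ⟨α, ⟨0, by simp⟩, hα⟩ ⟨_, ⟨t, rfl⟩, ht⟩
    exact ⟨_, by simpa [baseSkeleton] using hs, by simpa using V.smul_mem s hvV⟩
  · have hslice : IsClosed (Ω ∩ {y | y - α ∈ V}) :=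
      hΩ.inter (V.closed_of_finiteDimensional.preimage (continuous_sub_right α))
    obtain ⟨Φ, C, hΦ⟩ := exists_isStrictConcaveGauge hJ
    obtain ⟨x, ⟨hx, hxV⟩, -, p, -, hp⟩ := (hΦ.mono Set.inter_subset_left).exists_exposed_near
      hslice (l := 0) ⟨0, by rintro _ ⟨y, -, rfl⟩; rfl⟩ ⟨hα, by simp⟩ one_pos one_pos
    refine ⟨x, mem_baseSkeleton_of_forall_eq hm hx hV p fun y hy hyV hpy => ?_, hxV⟩
    by_contra hyx
    exact (hp y ⟨hy, by simpa using V.add_mem hyV hxV⟩ hyx).ne' hpy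

theorem baseSkeleton_subset (hΩ : IsClosed Ω) : baseSkeleton m Ω ⊆ Ω := by
  rw [baseSkeleton]
  split_ifs
  · exact hΩ.frontier_subset
  · exact Set.sep_subset _ _

theorem exists_mem_natSkeleton {S : Set (Fin n → ℝ) → Prop}
    (hS : ∀ Ω H, S Ω → IsClosed H → Convex ℝ H → S (Ω ∩ H)) {R : (Fin n → ℝ) → Prop}
    (hbase : ∀ Ω, S Ω → unbddCoords Ω = ∅ → ∀ α ∈ Ω, R α → ∃ x ∈ baseSkeleton m Ω, R x)
    {α : Fin n → ℝ} (hΩ : S Ω) (hα : α ∈ Ω) (hR : R α) : ∃ x ∈ natSkeleton m Ω, R x := by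
  induction Ω using natSkeleton.induct with
  | case1 Ω h ihnonneg ihnonpos =>
    have hproj := (LinearMap.proj (R := ℝ) (φ := fun _ : Fin n => ℝ)
      ((unbddCoords Ω).min' h)).isLinear
    rw [natSkeleton, dif_pos h]
    rcases le_total 0 (α ((unbddCoords Ω).min' h)) with h0 | h0
    · obtain ⟨x, hx, hxR⟩ := ihnonneg (hS _ _ hΩ
        (isClosed_le continuous_const (continuous_apply _)) (convex_halfSpace_ge hproj 0)) ⟨hα, h0⟩
      exact ⟨x, Or.inl hx, hxR⟩
    · obtain ⟨x, hx, hxR⟩ := ihnonpos (hS _ _ hΩ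
        (isClosed_le (continuous_apply _) continuous_const) (convex_halfSpace_le hproj 0)) ⟨hα, h0⟩
      exact ⟨x, Or.inr hx, hxR⟩
  | case2 Ω h =>
    rw [natSkeleton, dif_neg h]
    exact hbase Ω hΩ (Finset.not_nonempty_iff_eq_empty.1 h) α hα hR

theorem natSkeleton_subset (hΩ : IsClosed Ω) : natSkeleton m Ω ⊆ Ω := by
  induction Ω using natSkeleton.induct with
  | case1 Ω h ihnonneg ihnonpos =>
    rw [natSkeleton, dif_pos h]
    exact Set.union_subset
      ((ihnonneg (hΩ.inter (isClosed_le continuous_const (continuous_apply _)))).trans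
        (Set.sep_subset _ _))
      ((ihnonpos (hΩ.inter (isClosed_le (continuous_apply _) continuous_const))).trans
        (Set.sep_subset _ _))
  | case2 Ω h =>
    rw [natSkeleton, dif_neg h]
    exact baseSkeleton_subset hΩ

theorem skeleton_subset (k : ℤ) (hΩ : IsClosed Ω) : skeleton k Ω ⊆ Ω := by
  rw [skeleton]
  split_ifs
  · exact subset_rfl
  · exact natSkeleton_subset hΩ

theorem exists_mem_skeleton_apply_eq {W : Type*} [AddCommGroup W] [Module ℝ W] {k : ℤ}
    (hΩ : IsClosed Ω) (L : (Fin n → ℝ) →ₗ[ℝ] W)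
    (hL : k + 1 ≤ Module.finrank ℝ (LinearMap.ker L)) {α : Fin n → ℝ} (hα : α ∈ Ω) :
    ∃ x ∈ skeleton k Ω, L x = L α := by
  rw [skeleton]
  split_ifs with hk
  · exact ⟨α, hα, rfl⟩
  · refine exists_mem_natSkeleton (S := IsClosed) (fun _ _ hΩ hH _ => hΩ.inter hH)
      (R := fun x => L x = L α) (fun Ω' hΩ' hJ y hy hyα => ?_) hΩ hα rfl
    obtain ⟨x, hx, hxy⟩ := exists_mem_baseSkeleton_sub_mem (m := k.toNat)
      (V := LinearMap.ker L) hΩ' hJ (by omega) hy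
    rw [LinearMap.mem_ker, map_sub, sub_eq_zero] at hxy
    exact ⟨x, hx, hxy.trans hyα⟩

end Skeletons

section RealSlices

theorem exists_norm_add_eq_abs_norm_add {V : Type*} [AddCommGroup V] [Module ℝ V]
    (L : V →ₗ[ℝ] ℂ) (w : ℂ) :
    ∃ q l : V →ₗ[ℝ] ℝ, ∀ v, q v = 0 → ‖w + L v‖ = |‖w‖ + l v| := by
  obtain ⟨u, hu, huw⟩ := Complex.exists_norm_eq_mul_self w
  refine ⟨Complex.imLm ∘ₗ LinearMap.mulLeft ℝ u ∘ₗ L, Complex.reLm ∘ₗ LinearMap.mulLeft ℝ u ∘ₗ L,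
    fun v hv => ?_⟩
  have him : (u * L v).im = 0 := hv
  have hre : ((u * L v).re : ℂ) = u * L v := Complex.ext rfl him.symm
  calc ‖w + L v‖ = ‖u * (w + L v)‖ := by rw [norm_mul, hu, one_mul]
    _ = ‖((‖w‖ + (u * L v).re : ℝ) : ℂ)‖ := by
      rw [mul_add, ← huw, Complex.ofReal_add, hre]
    _ = |‖w‖ + (u * L v).re| := by rw [Complex.norm_real, Real.norm_eq_abs]

namespace IsStrictConcaveGauge

variable {E : Type*} [NormedAddCommGroup E] [NormedSpace ℝ E] [ProperSpace E] {Φ : E → ℝ}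
  {S : Set E} {C : ℝ}

theorem exists_abs_lt_forall_ne_of_convex (hΦ : IsStrictConcaveGauge Φ S C) (hS : IsClosed S)
    (hconv : Convex ℝ S) (l : StrongDual ℝ E) (c : ℝ) (h0 : ∀ y ∈ S, c + l y ≠ 0) {a : E}
    (ha : a ∈ S) (ha0 : 0 < c + l a) {ε : ℝ} (haε : c + l a < ε) :
    ∃ x ∈ S, |c + l x| < ε ∧ ∃ p : StrongDual ℝ E, ∀ y ∈ S, y ≠ x → p y ≠ p x := by
  have hpos : ∀ y ∈ S, 0 < c + l y := fun y hy => by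
    by_contra! hle
    obtain ⟨z, hz, hz0⟩ := hconv.isPreconnected.intermediate_value hy ha
      (f := fun y => c + l y) (by fun_prop) ⟨hle, ha0.le⟩
    exact h0 z hz hz0
  have hbdd : BddBelow (l '' S) := ⟨-c, by rintro _ ⟨y, hy, rfl⟩; linarith [hpos y hy]⟩
  obtain ⟨x, hx, hxl, p, -, hp⟩ := hΦ.exists_exposed_near hS hbdd ha (sub_pos.2 haε) one_pos
  exact ⟨x, hx, by rw [abs_of_pos (hpos x hx)]; linarith, p, fun y hy hyx => (hp y hy hyx).ne'⟩

theorem exists_abs_lt_forall_ne_of_isBounded (hΦ : IsStrictConcaveGauge Φ S C) (hS : IsClosed S)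
    (hbdd : Bornology.IsBounded S) (l : StrongDual ℝ E) (c : ℝ) (h0 : ∀ y ∈ S, c + l y ≠ 0)
    {a : E} (ha : a ∈ S) (ha0 : 0 < c + l a) {ε : ℝ} (haε : c + l a < ε) :
    ∃ x ∈ S, |c + l x| < ε ∧ ∃ p : StrongDual ℝ E, ∀ y ∈ S, y ≠ x → p y ≠ p x := by
  obtain ⟨s, hs, hsS⟩ : ∃ s > 0, ∀ y ∈ S, s ≤ |c + l y| :=
    (Metric.isCompact_of_isClosed_isBounded hS hbdd).exists_forall_le' (by fun_prop)
      fun y hy => abs_pos.2 (h0 y hy)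
  obtain ⟨D, hD⟩ := Metric.isBounded_iff.1 hbdd
  have hD0 : 0 ≤ D := dist_nonneg.trans (hD ha ha)
  have hQ : IsClosed {y ∈ S | 0 ≤ c + l y} :=
    hS.inter (isClosed_le continuous_const (continuous_const.add l.continuous))
  have hQbdd : BddBelow (l '' {y ∈ S | 0 ≤ c + l y}) :=
    ⟨-c, by rintro _ ⟨y, ⟨-, hy⟩, rfl⟩; linarith⟩
  obtain ⟨x, ⟨hxS, hx0⟩, hxl, p, hpl, hp⟩ := (hΦ.mono (Set.sep_subset _ _)).exists_exposed_near
    hQ hQbdd ⟨ha, ha0.le⟩ (sub_pos.2 haε) (ρ := s / (D + 1)) (by positivity)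
  refine ⟨x, hxS, by rw [abs_of_nonneg hx0]; linarith, p, fun y hy hyx => ?_⟩
  rcases le_or_gt 0 (c + l y) with hy0 | hy0
  · exact (hp y ⟨hy, hy0⟩ hyx).ne'
  · have hxs : s ≤ c + l x := abs_of_nonneg hx0 ▸ hsS x hxS
    have hpert : (p - l) (y - x) ≤ s / (D + 1) * D :=
      (le_abs_self _).trans ((p - l).le_of_opNorm_le_of_le hpl (dist_eq_norm y x ▸ hD hy hxS))
    have hsD : s / (D + 1) * D ≤ s := by
      rw [div_mul_eq_mul_div, div_le_iff₀ (by positivity)]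
      linarith
    -- `l` drops by more than `s` from `x` to `y`, and `p - l` makes up for at most `s` of it.
    simp only [sub_apply, map_sub] at hpert
    exact ne_of_lt (by linarith)

end IsStrictConcaveGauge

variable {n : ℕ} {Ω : Set (Fin n → ℝ)}

theorem exists_mem_baseSkeleton_norm_lt {m : ℕ} (hm : m ≠ 0) (hmn : m + 2 ≤ n)
    (hΩ : IsClosed Ω) (hΩ' : Convex ℝ Ω ∨ Bornology.IsBounded Ω) (hJ : unbddCoords Ω = ∅)
    (L : (Fin n → ℝ) →ₗ[ℝ] ℂ) (c : ℂ) (h0 : ∀ x ∈ Ω, c + L x ≠ 0) {ε : ℝ} {α : Fin n → ℝ}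
    (hα : α ∈ Ω) (hαε : ‖c + L α‖ < ε) : ∃ x ∈ baseSkeleton m Ω, ‖c + L x‖ < ε := by
  obtain ⟨q, l, hql⟩ := exists_norm_add_eq_abs_norm_add L (c + L α)
  set r : StrongDual ℝ (Fin n → ℝ) := LinearMap.toContinuousLinearMap l
  set P := Ω ∩ {y | q y = q α}
  have hnorm : ∀ y ∈ P, ‖c + L y‖ = |(‖c + L α‖ - r α) + r y| := fun y hy => by
    have hq : q (y - α) = 0 := by rw [map_sub, sub_eq_zero]; exact hy.2
    calc ‖c + L y‖ = ‖c + L α + L (y - α)‖ := by rw [map_sub]; congr 1; ring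
      _ = |‖c + L α‖ + r (y - α)| := hql _ hq
      _ = _ := by rw [map_sub]; congr 1; ring
  have hP : IsClosed P := hΩ.inter (isClosed_eq q.continuous_of_finiteDimensional continuous_const)
  obtain ⟨Φ, C, hΦ⟩ := exists_isStrictConcaveGauge hJ
  have hΦP := hΦ.mono (Set.inter_subset_left : P ⊆ Ω)
  have hP0 : ∀ y ∈ P, (‖c + L α‖ - r α) + r y ≠ 0 := fun y hy => by
    rw [← abs_pos, ← hnorm y hy]
    exact norm_pos_iff.2 (h0 y hy.1)
  have hαP : α ∈ P := ⟨hα, rfl⟩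
  have hα0 : 0 < (‖c + L α‖ - r α) + r α := by simpa using h0 α hα
  have hα1 : (‖c + L α‖ - r α) + r α < ε := by simpa using hαε
  obtain ⟨x, hx, hxε, p, hp⟩ : ∃ x ∈ P, |(‖c + L α‖ - r α) + r x| < ε ∧
      ∃ p : StrongDual ℝ (Fin n → ℝ), ∀ y ∈ P, y ≠ x → p y ≠ p x := by
    rcases hΩ' with hconv | hbdd
    · exact hΦP.exists_abs_lt_forall_ne_of_convex hP
        (hconv.inter (convex_hyperplane q.isLinear _)) r _ hP0 hαP hα0 hα1
    · exact hΦP.exists_abs_lt_forall_ne_of_isBounded hP (hbdd.subset Set.inter_subset_left) r _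
        hP0 hαP hα0 hα1
  have hq : n ≤ Module.finrank ℝ (LinearMap.ker q) + 1 := by
    simpa using finrank_le_finrank_ker_add_finrank q
  refine ⟨x, mem_baseSkeleton_of_forall_eq hm hx.1 (V := LinearMap.ker q) (by omega) p
    fun y hy hyq hpy => ?_, by rwa [hnorm x hx]⟩
  rw [LinearMap.mem_ker, map_sub, sub_eq_zero] at hyq
  by_contra hyx
  exact hp y ⟨hy, hyq.trans hx.2⟩ hyx hpy

theorem exists_mem_frontier_norm_lt {Ω : Set (Fin 2 → ℝ)} (hJ : unbddCoords Ω = ∅)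
    (L : (Fin 2 → ℝ) →ₗ[ℝ] ℂ) (c : ℂ) (h0 : ∀ x ∈ Ω, c + L x ≠ 0) {ε : ℝ} {α : Fin 2 → ℝ}
    (hα : α ∈ Ω) (hαε : ‖c + L α‖ < ε) : ∃ x ∈ frontier Ω, ‖c + L x‖ < ε := by
  have hstrip : IsPreconnected {x | ‖c + L x‖ < ε} := by
    have hball : {x | ‖c + L x‖ < ε} = L ⁻¹' Metric.ball (-c) ε := by
      ext x
      simp [dist_eq_norm, add_comm]
    rw [hball]
    exact ((convex_ball (-c) ε).linear_preimage L).isPreconnected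
  obtain ⟨y, hy, hyΩ⟩ : ∃ y, ‖c + L y‖ < ε ∧ y ∉ Ω := by
    by_cases hker : LinearMap.ker L = ⊥
    · have hdim : Module.finrank ℝ (Fin 2 → ℝ) = Module.finrank ℝ ℂ := by
        simp [Complex.finrank_real_complex]
      obtain ⟨y, hy⟩ := (LinearMap.injective_iff_surjective_of_finrank_eq_finrank hdim).1
        (LinearMap.ker_eq_bot.1 hker) (-c)
      have hy0 : c + L y = 0 := by rw [hy, add_neg_cancel]
      exact ⟨y, by rw [hy0, norm_zero]; exact (norm_nonneg _).trans_lt hαε, fun h => h0 y h hy0⟩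
    · obtain ⟨v, hv, hv0⟩ := Submodule.exists_mem_ne_zero_of_ne_bot hker
      obtain ⟨t, ht⟩ := exists_add_smul_notMem hJ α hv0
      refine ⟨_, ?_, ht⟩
      rwa [map_add, map_smul, LinearMap.mem_ker.1 hv, smul_zero, add_zero]
  obtain ⟨x, hx, hxf⟩ := inter_frontier_nonempty_of_isPreconnected hstrip ⟨α, hαε, hα⟩
    ⟨y, hy, hyΩ⟩
  exact ⟨x, hxf, hx⟩

theorem exists_mem_natSkeleton_norm_lt (hn : 2 ≤ n) (hΩ : IsClosed Ω)
    (hΩ' : n = 2 ∨ Convex ℝ Ω ∨ Bornology.IsBounded Ω) (L : (Fin n → ℝ) →ₗ[ℝ] ℂ) (c : ℂ)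
    (h0 : ∀ x ∈ Ω, c + L x ≠ 0) {ε : ℝ} {α : Fin n → ℝ} (hα : α ∈ Ω) (hαε : ‖c + L α‖ < ε) :
    ∃ x ∈ natSkeleton (n - 2) Ω, ‖c + L x‖ < ε := by
  refine exists_mem_natSkeleton
    (S := fun Ω => IsClosed Ω ∧ (n = 2 ∨ Convex ℝ Ω ∨ Bornology.IsBounded Ω) ∧
      ∀ x ∈ Ω, c + L x ≠ 0)
    (fun Ω H ⟨hΩ, hΩ', h0⟩ hH hHconv => ⟨hΩ.inter hH, ?_, fun x hx => h0 x hx.1⟩)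
    (R := fun x => ‖c + L x‖ < ε) (fun Ω ⟨hΩ, hΩ', h0⟩ hJ y hy hyε => ?_) ⟨hΩ, hΩ', h0⟩ hα hαε
  · exact hΩ'.imp_right (Or.imp (·.inter hHconv) (·.subset Set.inter_subset_left))
  · rcases eq_or_ne n 2 with rfl | hn2
    · simpa [baseSkeleton] using exists_mem_frontier_norm_lt hJ L c h0 hy hyε
    · exact exists_mem_baseSkeleton_norm_lt (by omega) (by omega) hΩ (hΩ'.resolve_left hn2) hJ L c
        h0 hy hyε

end RealSlices

section SkeletonEnclosures

variable {n : ℕ}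

/-- The linear part `α ↦ ∑ⱼ αⱼ f⁽ʲ⁾(ω)` of the real affine map `α ↦ t_α(ω)`. -/
noncomputable def coeffMap (f : Fin n → ℂ → ℂ) (ω : ℂ) : (Fin n → ℝ) →ₗ[ℝ] ℂ :=
  Fintype.linearCombination ℝ fun j => f j ω

theorem tFun_eq_add_coeffMap (f : Fin n → ℂ → ℂ) (g : ℂ → ℂ) (α : Fin n → ℝ) (ω : ℂ) :
    tFun f g α ω = g ω + coeffMap f ω α := by
  simp [tFun, coeffMap, Fintype.linearCombination_apply]

theorem ker_coeffMap (f : Fin n → ℂ → ℂ) (ω : ℂ) :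
    LinearMap.ker (coeffMap f ω) = LinearMap.ker (coeffMatrix f ω).mulVecLin := by
  ext α
  simp [coeffMap, Fintype.linearCombination_apply, coeffMatrix, dotProduct, Complex.ext_iff,
    funext_iff, Fin.forall_fin_two, mul_comm]

theorem rank_coeffMatrix_add_finrank_ker_coeffMap (f : Fin n → ℂ → ℂ) (ω : ℂ) :
    (coeffMatrix f ω).rank + Module.finrank ℝ (LinearMap.ker (coeffMap f ω)) = n := by
  rw [ker_coeffMap, Matrix.rank, LinearMap.finrank_range_add_finrank_ker, Module.finrank_fin_fun]

variable {Ω : Set (Fin n → ℝ)} {𝒞 : Set ℂ} {f : Fin n → ℂ → ℂ} {g : ℂ → ℂ} {ω : ℂ} {ε : ℝ}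

theorem exists_mem_skeleton_norm_tFun_lt (hΩ : IsClosed Ω) (h0 : ∀ α ∈ Ω, tFun f g α ω ≠ 0)
    {α : Fin n → ℝ} (hα : α ∈ Ω) (hαε : ‖tFun f g α ω‖ < ε) :
    ∃ x ∈ skeleton (skeletonIndex Ω) Ω, ‖tFun f g x ω‖ < ε := by
  simp only [tFun_eq_add_coeffMap] at h0 hαε ⊢
  rw [skeletonIndex]
  split_ifs with hΩ'
  · rw [skeleton]
    split_ifs with hneg
    · exact ⟨α, hα, hαε⟩
    · rw [show ((n : ℤ) - 2).toNat = n - 2 by omega]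
      exact exists_mem_natSkeleton_norm_lt (by omega) hΩ hΩ' _ _ h0 hα hαε
  · have hker : n ≤ Module.finrank ℝ (LinearMap.ker (coeffMap f ω)) + 2 := by
      simpa [Complex.finrank_real_complex] using
        finrank_le_finrank_ker_add_finrank (coeffMap f ω)
    obtain ⟨x, hx, hxα⟩ := exists_mem_skeleton_apply_eq (k := (n : ℤ) - 3) hΩ (coeffMap f ω)
      (by omega) hα
    exact ⟨x, hx, by rwa [hxα]⟩

theorem exists_mem_skeleton_tFun_eq (hΩ : IsClosed Ω) (hrank : (coeffMatrix f ω).rank < 2)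
    {α : Fin n → ℝ} (hα : α ∈ Ω) :
    ∃ x ∈ skeleton ((n : ℤ) - 2) Ω, tFun f g x ω = tFun f g α ω := by
  have hdim := rank_coeffMatrix_add_finrank_ker_coeffMap f ω
  obtain ⟨x, hx, hxα⟩ := exists_mem_skeleton_apply_eq (k := (n : ℤ) - 2) hΩ (coeffMap f ω)
    (by omega) hα
  exact ⟨x, hx, by rw [tFun_eq_add_coeffMap, tFun_eq_add_coeffMap, hxα]⟩

theorem pseudoEnclosure_mono {X Y : Set (Fin n → ℝ)} (hXY : X ⊆ Y) {ε' : ℝ} (hε : ε ≤ ε') :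
    pseudoEnclosure 𝒞 f g X ε ⊆ pseudoEnclosure 𝒞 f g Y ε' :=
  fun _ ⟨hω, α, hα, hαε⟩ => ⟨hω, α, hXY hα, hαε.trans_le hε⟩

theorem pseudoEnclosure_skeleton_diff_enclosure (hΩ : IsClosed Ω) :
    pseudoEnclosure 𝒞 f g (skeleton (skeletonIndex Ω) Ω) ε \ enclosure 𝒞 f g Ω =
      pseudoEnclosure 𝒞 f g Ω ε \ enclosure 𝒞 f g Ω := by
  refine Set.Subset.antisymm
    (Set.sdiff_subset_sdiff_left (pseudoEnclosure_mono (skeleton_subset _ hΩ) le_rfl)) ?_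
  rintro ω ⟨⟨hω, α, hα, hαε⟩, hω0⟩
  exact ⟨⟨hω, exists_mem_skeleton_norm_tFun_lt hΩ (fun β hβ h => hω0 ⟨hω, β, hβ, h⟩) hα hαε⟩, hω0⟩

theorem pseudoEnclosure_skeleton_inter_degenerateSet (hΩ : IsClosed Ω) :
    pseudoEnclosure 𝒞 f g (skeleton ((n : ℤ) - 2) Ω) ε ∩ degenerateSet 𝒞 f =
      pseudoEnclosure 𝒞 f g Ω ε ∩ degenerateSet 𝒞 f := by
  refine Set.Subset.antisymm
    (Set.inter_subset_inter_left _ (pseudoEnclosure_mono (skeleton_subset _ hΩ) le_rfl)) ?_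
  rintro ω ⟨⟨hω, α, hα, hαε⟩, hω'⟩
  obtain ⟨x, hx, hxα⟩ := exists_mem_skeleton_tFun_eq (g := g) hΩ hω'.2 hα
  exact ⟨⟨hω, x, hx, by rwa [hxα]⟩, hω'⟩

end SkeletonEnclosures

section NonvanishingLimits

variable {E : Type*} [NormedAddCommGroup E] [NormedSpace ℂ E] [Nontrivial E] {U : Set E}

theorem le_norm_of_forall_mem_frontier_le_norm (hU : Bornology.IsBounded U) {F : E → ℂ}
    (hF : DiffContOnCl ℂ F U) (hF0 : ∀ z ∈ closure U, F z ≠ 0) {m : ℝ}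
    (hm : ∀ z ∈ frontier U, m ≤ ‖F z‖) {z : E} (hz : z ∈ closure U) : m ≤ ‖F z‖ := by
  rcases le_or_gt m 0 with hm0 | hm0
  · exact hm0.trans (norm_nonneg _)
  have hinv : ‖(F z)⁻¹‖ ≤ m⁻¹ :=
    Complex.norm_le_of_forall_mem_frontier_norm_le hU (hF.inv hF0)
      (fun w hw => by
        rw [Pi.inv_apply, norm_inv]
        exact inv_anti₀ hm0 (hm w hw)) hz
  rw [norm_inv] at hinv
  exact (inv_le_inv₀ (norm_pos_iff.2 (hF0 z hz)) hm0).1 hinv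

theorem ne_zero_of_tendstoUniformlyOn_closure [ProperSpace E] (hU : Bornology.IsBounded U)
    {ι : Type*} {p : Filter ι} [p.NeBot] {F : ι → E → ℂ} {G : E → ℂ}
    (hFG : TendstoUniformlyOn F G p (closure U))
    (hF : ∀ᶠ i in p, DiffContOnCl ℂ (F i) U ∧ ∀ z ∈ closure U, F i z ≠ 0)
    (hG : ∀ z ∈ frontier U, G z ≠ 0) {z : E} (hz : z ∈ closure U) : G z ≠ 0 := by
  have hGc : ContinuousOn G (closure U) :=
    hFG.continuousOn (hF.mono fun _ hi => hi.1.continuousOn).frequently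
  obtain ⟨μ, hμ, hμG⟩ :=
    (hU.isCompact_closure.of_isClosed_subset isClosed_frontier
      frontier_subset_closure).exists_forall_le' (hGc.mono frontier_subset_closure).norm
      fun w hw => norm_pos_iff.2 (hG w hw)
  obtain ⟨i, ⟨hid, hi0⟩, hi⟩ :=
    (hF.and (Metric.tendstoUniformlyOn_iff.1 hFG (μ / 2) (half_pos hμ))).exists
  simp only [dist_eq_norm] at hi
  have hFz : μ / 2 ≤ ‖F i z‖ := by
    refine le_norm_of_forall_mem_frontier_le_norm hU hid hi0 (fun w hw => ?_) hz
    linarith [hμG w hw, hi w (frontier_subset_closure hw), norm_sub_norm_le (G w) (F i w)]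
  intro hGz
  have := hi z hz
  rw [hGz, zero_sub, norm_neg] at this
  exact hFz.not_gt this

end NonvanishingLimits

section IndependentGerms

variable {ι : Type*} [Fintype ι] {h : ι → ℂ → ℂ} {ω : ℂ}

theorem eventually_sum_smul_ne_zero (hh : ∀ i, AnalyticAt ℂ (h i) ω)
    (hli : LinearIndependent ℝ fun i => (h i : Germ (𝓝 ω) ℂ)) {β : ι → ℝ} (hβ : β ≠ 0) :
    ∀ᶠ z in 𝓝[≠] ω, ∑ i, β i • h i z ≠ 0 := by
  have han : AnalyticAt ℂ (fun z => ∑ i, β i • h i z) ω :=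
    Finset.analyticAt_fun_sum _ fun i _ => (hh i).fun_const_smul
  refine han.eventually_eq_zero_or_eventually_ne_zero.resolve_left fun hzero => hβ ?_
  refine funext (Fintype.linearIndependent_iff.1 hli β ?_)
  have hsum : ∑ i, β i • (h i : Germ (𝓝 ω) ℂ) = Germ.coeRingHom (𝓝 ω) (∑ i, β i • h i) := by
    rw [map_sum]
    rfl
  rw [hsum]
  exact Germ.coe_eq.2 (hzero.mono fun z hz => by simpa using hz)

theorem tendstoUniformlyOn_sum_smul {X : Type*} [TopologicalSpace X] {h : ι → X → ℂ} {K : Set X}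
    (hK : IsCompact K) (hh : ∀ i, ContinuousOn (h i) K) (β : ι → ℝ) :
    TendstoUniformlyOn (fun γ z => ∑ i, γ i • h i z) (fun z => ∑ i, β i • h i z) (𝓝 β) K := by
  have hcont : ContinuousOn (Function.uncurry fun (γ : ι → ℝ) z => ∑ i, γ i • h i z)
      (Set.univ ×ˢ K) :=
    continuousOn_finsetSum _ fun i _ => ((continuous_apply i).comp continuous_fst).continuousOn.smul
      ((hh i).comp continuousOn_snd fun _ hx => hx.2)
  intro u hu
  obtain ⟨v, hv, hvu⟩ := hK.mem_uniformity_of_prod hcont (Set.mem_univ β) (symm_le_uniformity hu)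
  rw [nhdsWithin_univ] at hv
  exact mem_of_superset hv hvu

theorem sum_smul_ne_zero_of_mem_closure (hh : ∀ i, AnalyticAt ℂ (h i) ω)
    (hli : LinearIndependent ℝ fun i => (h i : Germ (𝓝 ω) ℂ)) {S : Set (ι → ℝ)}
    (hS : ∀ᶠ z in 𝓝 ω, ∀ γ ∈ S, ∑ i, γ i • h i z ≠ 0) {β : ι → ℝ} (hβS : β ∈ closure S)
    (hβ : β ≠ 0) : ∑ i, β i • h i ω ≠ 0 := by
  obtain ⟨r, hr, hball⟩ := Metric.nhds_basis_closedBall.eventually_iff.1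
    ((hS.and (eventually_nhdsWithin_iff.1 (eventually_sum_smul_ne_zero hh hli hβ))).and
      (eventually_all.2 fun i => (hh i).eventually_analyticAt))
  rw [← closure_ball ω hr.ne'] at hball
  have hcont (i : ι) : ContinuousOn (h i) (closure (Metric.ball ω r)) := fun z hz =>
    ((hball hz).2 i).continuousAt.continuousWithinAt
  have hdiff (γ : ι → ℝ) : DifferentiableOn ℂ (fun z => ∑ i, γ i • h i z)
      (closure (Metric.ball ω r)) := fun z hz =>
    (DifferentiableAt.fun_sum fun i _ =>
      ((hball hz).2 i).differentiableAt.const_smul (γ i)).differentiableWithinAt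
  have := mem_closure_iff_nhdsWithin_neBot.1 hβS
  have hlim : TendstoUniformlyOn (fun γ z => ∑ i, γ i • h i z) (fun z => ∑ i, β i • h i z)
      (𝓝[S] β) (closure (Metric.ball ω r)) := fun u hu => nhdsWithin_le_nhds
    (tendstoUniformlyOn_sum_smul Metric.isBounded_ball.isCompact_closure hcont β u hu)
  refine ne_zero_of_tendstoUniformlyOn_closure Metric.isBounded_ball hlim ?_ (fun z hz => ?_)
    (subset_closure (Metric.mem_ball_self hr))
  · filter_upwards [self_mem_nhdsWithin] with γ hγ
    exact ⟨(hdiff γ).diffContOnCl, fun z hz => (hball hz).1.1 γ hγ⟩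
  · refine (hball (frontier_subset_closure hz)).1.2 ?_
    rw [frontier_ball ω hr.ne'] at hz
    exact Metric.ne_of_mem_sphere hz hr.ne'

theorem exists_forall_mul_norm_le_norm_sum_smul (hh : ∀ i, AnalyticAt ℂ (h i) ω)
    (hli : LinearIndependent ℝ fun i => (h i : Germ (𝓝 ω) ℂ)) {S : Set (ι → ℝ)}
    (hS : ∀ᶠ z in 𝓝 ω, ∀ γ ∈ S, ∑ i, γ i • h i z ≠ 0) :
    ∃ μ > 0, ∀ γ ∈ S, μ * ‖γ‖ ≤ ‖∑ i, γ i • h i ω‖ := by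
  have hsmul (c : ℝ) (γ : ι → ℝ) (z : ℂ) :
      ∑ i, (c • γ) i • h i z = c • ∑ i, γ i • h i z := by
    simp only [Pi.smul_apply, Finset.smul_sum, smul_assoc]
  have hpos : ∀ γ ∈ S, 0 < ‖γ‖ := by
    rintro γ hγ
    refine norm_pos_iff.2 ?_
    rintro rfl
    exact hS.self_of_nhds 0 hγ (by simp)
  set T : Set (ι → ℝ) := (fun γ => ‖γ‖⁻¹ • γ) '' S
  have hTsphere : closure T ⊆ Metric.sphere 0 1 := by
    refine closure_minimal ?_ Metric.isClosed_sphere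
    rintro _ ⟨γ, hγ, rfl⟩
    rw [mem_sphere_zero_iff_norm, norm_smul, norm_inv, norm_norm, inv_mul_cancel₀ (hpos γ hγ).ne']
  have hTne : ∀ᶠ z in 𝓝 ω, ∀ γ ∈ T, ∑ i, γ i • h i z ≠ 0 := by
    filter_upwards [hS] with z hz
    rintro _ ⟨γ, hγ, rfl⟩
    rw [hsmul]
    exact smul_ne_zero (inv_ne_zero (hpos γ hγ).ne') (hz γ hγ)
  have hTcl : ∀ γ ∈ closure T, 0 < ‖∑ i, γ i • h i ω‖ := fun γ hγ =>
    norm_pos_iff.2 (sum_smul_ne_zero_of_mem_closure hh hli hTne hγ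
      (Metric.ne_of_mem_sphere (hTsphere hγ) one_ne_zero))
  obtain ⟨μ, hμ, hμT⟩ := ((isCompact_sphere 0 1).of_isClosed_subset isClosed_closure
    hTsphere).exists_forall_le' (by fun_prop) hTcl
  refine ⟨μ, hμ, fun γ hγ => ?_⟩
  have hμγ := hμT _ (subset_closure ⟨γ, hγ, rfl⟩)
  rwa [hsmul, norm_smul, norm_inv, norm_norm, le_inv_mul_iff₀ (hpos γ hγ), mul_comm] at hμγ

end IndependentGerms

theorem eventually_norm_eq_of_isLocalMin_norm {F : ℂ → ℂ} {ω : ℂ} (hF : AnalyticAt ℂ F ω)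
    (hmin : IsLocalMin (norm ∘ F) ω) (hFω : F ω ≠ 0) : ∀ᶠ z in 𝓝 ω, ‖F z‖ = ‖F ω‖ := by
  have hdiff : ∀ᶠ z in 𝓝 ω, DifferentiableAt ℂ F z :=
    hF.eventually_analyticAt.mono fun _ hz => hz.differentiableAt
  have hconst := (Complex.eventually_eq_or_eq_zero_of_isLocalMin_norm hdiff hmin).resolve_right hFω
  exact hconst.mono fun z hz => congrArg norm hz

section Boundary

variable {n : ℕ} {Ω : Set (Fin n → ℝ)} {𝒞 : Set ℂ} {f : Fin n → ℂ → ℂ} {g : ℂ → ℂ} {ω : ℂ} {ε : ℝ}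

theorem infModulus_empty : infModulus f g ∅ ω = 0 := by
  rw [infModulus, Set.image_empty, Real.sInf_empty]

theorem infModulus_le {α : Fin n → ℝ} (hα : α ∈ Ω) : infModulus f g Ω ω ≤ ‖tFun f g α ω‖ :=
  csInf_le ⟨0, Set.forall_mem_image.2 fun _ _ => norm_nonneg _⟩ (Set.mem_image_of_mem _ hα)

theorem exists_norm_tFun_lt (hΩ : Ω.Nonempty) (h : infModulus f g Ω ω < ε) :
    ∃ α ∈ Ω, ‖tFun f g α ω‖ < ε :=
  Set.exists_mem_image.1 (exists_lt_of_csInf_lt (hΩ.image _) h)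

theorem continuousAt_tFun (hω : ω ∈ contSet 𝒞 f g) (α : Fin n → ℝ) :
    ContinuousAt (tFun f g α) ω :=
  hω.2.1.add (tendsto_finsetSum _ fun j _ => continuousAt_const.mul (hω.2.2 j))

theorem mem_interior_pseudoEnclosure (h𝒞 : IsOpen 𝒞) (hΩ : Ω.Nonempty)
    (hω : ω ∈ contSet 𝒞 f g) (h : infModulus f g Ω ω < ε) :
    ω ∈ interior (pseudoEnclosure 𝒞 f g Ω ε) := by
  obtain ⟨α, hα, hαω⟩ := exists_norm_tFun_lt hΩ h
  rw [mem_interior_iff_mem_nhds]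
  filter_upwards [h𝒞.mem_nhds hω.1, (continuousAt_tFun hω α).norm.eventually_lt_const hαω]
    with z hz hαz
  exact ⟨hz, α, hα, hαz⟩

theorem notMem_pseudoEnclosure (h : ε ≤ infModulus f g Ω ω) :
    ω ∉ pseudoEnclosure 𝒞 f g Ω ε :=
  fun ⟨_, _, hα, hαω⟩ => hαω.not_ge (h.trans (infModulus_le hα))

theorem infModulus_eq_of_mem_frontier (h𝒞 : IsOpen 𝒞) (hω : ω ∈ contSet 𝒞 f g)
    (hfr : ω ∈ frontier (pseudoEnclosure 𝒞 f g Ω ε))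
    (hfr' : ∀ ε' > ε, ω ∉ frontier (pseudoEnclosure 𝒞 f g Ω ε')) : infModulus f g Ω ω = ε := by
  obtain ⟨-, -, α, hα, -⟩ := closure_nonempty_iff.1 ⟨ω, hfr.1⟩
  refine le_antisymm (not_lt.1 fun hlt => ?_)
    (not_lt.1 fun hlt => hfr.2 (mem_interior_pseudoEnclosure h𝒞 ⟨α, hα⟩ hω hlt))
  obtain ⟨ε', hε', hε'ω⟩ := exists_between hlt
  exact hfr' ε' hε' ⟨closure_mono (pseudoEnclosure_mono subset_rfl hε'.le) hfr.1,
    fun hint => notMem_pseudoEnclosure hε'ω.le (interior_subset hint)⟩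

theorem holoSet_subset_contSet : holoSet 𝒞 f g Ω ε ⊆ contSet 𝒞 f g :=
  fun _ hω => ⟨hω.1, hω.2.1.continuousAt, fun j => (hω.2.2.1 j).continuousAt⟩

theorem tFun_eq_sum_cons (α : Fin n → ℝ) (z : ℂ) :
    tFun f g α z = ∑ i, (Fin.cons 1 α : Fin (n + 1) → ℝ) i • (Fin.cons g f : _ → ℂ → ℂ) i z := by
  simp [tFun, Fin.sum_univ_succ]

theorem exists_forall_mul_norm_le_norm_tFun (hω : ω ∈ holoSet 𝒞 f g Ω ε)
    (h : ∀ᶠ z in 𝓝 ω, ∀ α ∈ Ω, tFun f g α z ≠ 0) :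
    ∃ μ > 0, ∀ α ∈ Ω, μ * ‖α‖ ≤ ‖tFun f g α ω‖ := by
  obtain ⟨-, hg, hf, hli, -⟩ := hω
  obtain ⟨μ, hμ, hμS⟩ := exists_forall_mul_norm_le_norm_sum_smul (Fin.cases hg hf) hli
    (S := (fun α => (Fin.cons 1 α : Fin (n + 1) → ℝ)) '' Ω)
    (by simpa only [Set.forall_mem_image, ← tFun_eq_sum_cons] using h)
  refine ⟨μ, hμ, fun α hα => ?_⟩
  rw [tFun_eq_sum_cons]
  refine le_trans ?_ (hμS _ (Set.mem_image_of_mem _ hα))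
  gcongr
  exact (pi_norm_le_iff_of_nonneg (norm_nonneg _)).2 fun j =>
    norm_le_pi_norm (Fin.cons 1 α : Fin (n + 1) → ℝ) j.succ

theorem exists_norm_tFun_eq_infModulus (hΩ : IsClosed Ω) (hne : Ω.Nonempty)
    (hω : ω ∈ holoSet 𝒞 f g Ω ε) (h : ∀ᶠ z in 𝓝 ω, ∀ α ∈ Ω, tFun f g α z ≠ 0) :
    ∃ α ∈ Ω, ‖tFun f g α ω‖ = infModulus f g Ω ω := by
  obtain ⟨μ, hμ, hμΩ⟩ := exists_forall_mul_norm_le_norm_tFun hω h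
  have hcont : Continuous fun α : Fin n → ℝ => ‖tFun f g α ω‖ := by
    unfold tFun
    fun_prop
  obtain ⟨α₀, hα₀⟩ := hne
  have hcoercive : ∀ᶠ α in cocompact (Fin n → ℝ) ⊓ 𝓟 Ω, ‖tFun f g α₀ ω‖ ≤ ‖tFun f g α ω‖ := by
    rw [eventually_inf_principal]
    filter_upwards [(tendsto_norm_cocompact_atTop.const_mul_atTop hμ).eventually_ge_atTop
      ‖tFun f g α₀ ω‖] with α hα hαΩ using hα.trans (hμΩ α hαΩ)
  obtain ⟨α, hα, hmin⟩ := hcont.continuousOn.exists_isMinOn' hΩ hα₀ hcoercive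
  refine ⟨α, hα, le_antisymm (le_csInf ⟨_, Set.mem_image_of_mem _ hα⟩ ?_) (infModulus_le hα)⟩
  exact Set.forall_mem_image.2 fun β hβ => hmin hβ

theorem mem_closure_pseudoEnclosure (h𝒞 : IsOpen 𝒞) (hΩ : IsClosed Ω) (hne : Ω.Nonempty)
    (hε : 0 < ε) (hω : ω ∈ holoSet 𝒞 f g Ω ε) (h : infModulus f g Ω ω = ε) :
    ω ∈ closure (pseudoEnclosure 𝒞 f g Ω ε) := by
  by_contra hcl
  have hlow : ∀ᶠ z in 𝓝 ω, ∀ α ∈ Ω, ε ≤ ‖tFun f g α z‖ := by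
    filter_upwards [isClosed_closure.isOpen_compl.mem_nhds hcl, h𝒞.mem_nhds hω.1]
      with z hz hz𝒞 α hα
    exact not_lt.1 fun hlt => hz (subset_closure ⟨hz𝒞, α, hα, hlt⟩)
  obtain ⟨α, hα, hαω⟩ := exists_norm_tFun_eq_infModulus hΩ hne hω
    (hlow.mono fun z hz α hα => norm_pos_iff.1 (hε.trans_le (hz α hα)))
  rw [h] at hαω
  have han : AnalyticAt ℂ (tFun f g α) ω :=
    hω.2.1.add (Finset.analyticAt_fun_sum _ fun j _ => analyticAt_const.mul (hω.2.2.1 j))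
  have hmin : IsLocalMin (norm ∘ tFun f g α) ω := hlow.mono fun z hz => hαω.trans_le (hz α hα)
  have hconst := eventually_norm_eq_of_isLocalMin_norm han hmin
    (norm_pos_iff.1 (hε.trans_eq hαω.symm))
  rw [hαω] at hconst
  exact hω.2.2.2.2 α hα hconst

theorem mem_frontier_pseudoEnclosure_of_infModulus_eq (h𝒞 : IsOpen 𝒞) (hΩ : IsClosed Ω)
    (hε : 0 < ε) (hω : ω ∈ holoSet 𝒞 f g Ω ε) (h : infModulus f g Ω ω = ε) :
    ω ∈ frontier (pseudoEnclosure 𝒞 f g Ω ε) ∧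
      ∀ ε' > ε, ω ∉ frontier (pseudoEnclosure 𝒞 f g Ω ε') := by
  rcases Ω.eq_empty_or_nonempty with rfl | hne
  · exact absurd (infModulus_empty.symm.trans h) hε.ne
  · exact ⟨⟨mem_closure_pseudoEnclosure h𝒞 hΩ hne hε hω h,
      fun hint => notMem_pseudoEnclosure h.ge (interior_subset hint)⟩, fun ε' hε' hfr =>
      hfr.2 (mem_interior_pseudoEnclosure h𝒞 hne (holoSet_subset_contSet hω) (h.trans_lt hε'))⟩

end Boundary

theorem mainTheorem3_general {n : ℕ} {𝒞 : Set ℂ} (h𝒞 : IsOpen 𝒞) (f : Fin n → ℂ → ℂ) (g : ℂ → ℂ)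
    {Ω : Set (Fin n → ℝ)} (hΩ : IsClosed Ω) {ε : ℝ} (hε : 0 < ε) :
    (pseudoEnclosure 𝒞 f g (skeleton (skeletonIndex Ω) Ω) ε \ enclosure 𝒞 f g Ω =
      pseudoEnclosure 𝒞 f g Ω ε \ enclosure 𝒞 f g Ω) ∧
    (pseudoEnclosure 𝒞 f g (skeleton ((n : ℤ) - 2) Ω) ε ∩ degenerateSet 𝒞 f =
      pseudoEnclosure 𝒞 f g Ω ε ∩ degenerateSet 𝒞 f) ∧
    ({ω | ω ∈ frontier (pseudoEnclosure 𝒞 f g Ω ε) ∩ contSet 𝒞 f g ∧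
        ∀ ε' > ε, ω ∉ frontier (pseudoEnclosure 𝒞 f g Ω ε')} ⊆
      {ω | ω ∈ contSet 𝒞 f g ∧ infModulus f g Ω ω = ε}) ∧
    ({ω | ω ∈ frontier (pseudoEnclosure 𝒞 f g Ω ε) ∩ holoSet 𝒞 f g Ω ε ∧
        ∀ ε' > ε, ω ∉ frontier (pseudoEnclosure 𝒞 f g Ω ε')} =
      {ω | ω ∈ holoSet 𝒞 f g Ω ε ∧ infModulus f g Ω ω = ε}) := by
  refine ⟨pseudoEnclosure_skeleton_diff_enclosure hΩ,
    pseudoEnclosure_skeleton_inter_degenerateSet hΩ, ?_, Set.Subset.antisymm ?_ ?_⟩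
  · rintro ω ⟨⟨hfr, hω⟩, hfr'⟩
    exact ⟨hω, infModulus_eq_of_mem_frontier h𝒞 hω hfr hfr'⟩
  · rintro ω ⟨⟨hfr, hω⟩, hfr'⟩
    exact ⟨hω, infModulus_eq_of_mem_frontier h𝒞 (holoSet_subset_contSet hω) hfr hfr'⟩
  · rintro ω ⟨hω, h⟩
    obtain ⟨hfr, hfr'⟩ := mem_frontier_pseudoEnclosure_of_infModulus_eq h𝒞 hΩ hε hω h
    exact ⟨⟨hfr, hω⟩, hfr'⟩

theorem mainTheorem3 {E : Type*} [NormedAddCommGroup E] [InnerProductSpace ℂ E] [CompleteSpace E]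
    {n : ℕ} (hn : 1 ≤ n)
    (A : Fin n → E →ₗ.[ℂ] E) (hA : ∀ j, IsSelfAdjoint (A j))
    (hdense : Dense (commonDomain A : Set E))
    (𝒞 : Set ℂ) (h𝒞_open : IsOpen 𝒞) (h𝒞_dense : Dense 𝒞)
    (f : Fin n → ℂ → ℂ) (g : ℂ → ℂ)
    (hclosable : ∀ ω ∈ 𝒞, (preOperator A f g ω).IsClosable)
    (Ω : Set (Fin n → ℝ)) (hΩ_closed : IsClosed Ω)
    (hΩ_lower : jointNumRange A ⊆ Ω)
    (hΩ_upper : Ω ⊆ Set.univ.pi (fun j => closure (numRange (A j))))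
    (ε : ℝ) (hε : 0 < ε) :
    (pseudoEnclosure 𝒞 f g (skeleton (skeletonIndex Ω) Ω) ε \ enclosure 𝒞 f g Ω =
      pseudoEnclosure 𝒞 f g Ω ε \ enclosure 𝒞 f g Ω) ∧
    ((pseudoEnclosure 𝒞 f g (skeleton ((n : ℤ) - 2) Ω) ε ∩ degenerateSet 𝒞 f) \
        enclosure 𝒞 f g Ω =
      (pseudoEnclosure 𝒞 f g Ω ε ∩ degenerateSet 𝒞 f) \ enclosure 𝒞 f g Ω) ∧
    ({ω | ω ∈ frontier (pseudoEnclosure 𝒞 f g Ω ε) ∩ contSet 𝒞 f g ∧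
        ∀ ε' > ε, ω ∉ frontier (pseudoEnclosure 𝒞 f g Ω ε')} ⊆
      {ω | ω ∈ contSet 𝒞 f g ∧ infModulus f g Ω ω = ε}) ∧
    ({ω | ω ∈ frontier (pseudoEnclosure 𝒞 f g Ω ε) ∩ holoSet 𝒞 f g Ω ε ∧
        ∀ ε' > ε, ω ∉ frontier (pseudoEnclosure 𝒞 f g Ω ε')} =
      {ω | ω ∈ holoSet 𝒞 f g Ω ε ∧ infModulus f g Ω ω = ε}) := by
  obtain ⟨hskel, hdeg, hcont, hholo⟩ := mainTheorem3_general h𝒞_open f g hΩ_closed hε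
  exact ⟨hskel, by rw [hdeg], hcont, hholo⟩
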